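/- Let $(p_i)_{i \ge 1}$ be a sequence in $[0,1]$ with $0 < \liminf_{i\to\infty} p_i \le \limsup_{i\to\infty} p_i < 1$. For each $N \in \mathbb{N}$ let $Y_1, \dots, Y_N$ be independent random variables with $Y_i \sim \operatorname{Bernoulli}(p_i)$ (on a probability space that may depend on $N$), and put $X = \sum_{i=1}^N Y_i$ and $S_N = \sum_{i=1}^N p_i(1-p_i)$. Then $$\frac{1}{\sqrt{S_N}}\left(X - \sum_{i=1}^N p_i\right) \xrightarrow{d} \mathcal{N}(0,1) \qquad \text{as } N \to \infty .$$ (The assumption gives $S_N > 0$ for all large $N$; the finitely many $N$ with $S_N = 0$ are irrelevant to the limit.) -/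

import Mathlib

open MeasureTheory ProbabilityTheory Filter

/-! By Lévy's continuity theorem, pointwise convergence of characteristic functions suffices. With u
= t/√S_N, the limit exp(-t²/2) splits as ∏ exp(-p_i(1-p_i)u²/2), and independence splits the other
side. Exchanging factors one at a time bounds the difference of the products by the sum of the
factor differences, since all factors lie in the unit disc. A Taylor expansion bounds each by
2p_i(1-p_i)|u|³, so the total is at most 2 S_N|u|³ = 2t²|u|, which vanishes because S_N → ∞. -/

lemma norm_prod_sub_prod_le_sum {ι 𝕜 : Type*} [NormedField 𝕜] (s : Finset ι) (a b : ι → 𝕜)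
    (ha : ∀ i ∈ s, ‖a i‖ ≤ 1) (hb : ∀ i ∈ s, ‖b i‖ ≤ 1) :
    ‖∏ i ∈ s, a i - ∏ i ∈ s, b i‖ ≤ ∑ i ∈ s, ‖a i - b i‖ := by
  classical
  induction s using Finset.induction with
  | empty => simp
  | insert j s hj ih =>
    rw [Finset.prod_insert hj, Finset.prod_insert hj, Finset.sum_insert hj]
    have hb' : ‖∏ i ∈ s, b i‖ ≤ 1 := by
      rw [norm_prod]
      exact Finset.prod_le_one (fun _ _ => norm_nonneg _)
        fun i hi => hb i (Finset.mem_insert_of_mem hi)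
    have ih' := ih (fun i hi => ha i (Finset.mem_insert_of_mem hi))
      (fun i hi => hb i (Finset.mem_insert_of_mem hi))
    calc ‖a j * ∏ i ∈ s, a i - b j * ∏ i ∈ s, b i‖
        = ‖(a j - b j) * ∏ i ∈ s, b i + a j * (∏ i ∈ s, a i - ∏ i ∈ s, b i)‖ := by
          congr 1; ring
      _ ≤ ‖a j - b j‖ * ‖∏ i ∈ s, b i‖ + ‖a j‖ * ‖∏ i ∈ s, a i - ∏ i ∈ s, b i‖ := by
          grw [norm_add_le, norm_mul, norm_mul]
      _ ≤ ‖a j - b j‖ * 1 + 1 * ∑ i ∈ s, ‖a i - b i‖ := by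
          gcongr
          exact ha j (Finset.mem_insert_self j s)
      _ = _ := by ring

lemma norm_exp_mul_I_sub_taylor_two_le {x : ℝ} (hx : |x| ≤ 1) :
    ‖Complex.exp (x * Complex.I) - (1 + x * Complex.I - (x : ℂ) ^ 2 / 2)‖ ≤ |x| ^ 3 := by
  have h := Complex.exp_bound (x := x * Complex.I) (by simpa using hx) (n := 3) (by norm_num)
  have e : ∑ m ∈ Finset.range 3, ((x : ℂ) * Complex.I) ^ m / m.factorial
      = 1 + x * Complex.I - (x : ℂ) ^ 2 / 2 := by
    simp [Finset.sum_range_succ, mul_pow, Nat.factorial]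
    ring
  rw [e] at h
  refine h.trans ?_
  simp only [norm_mul, Complex.norm_real, Complex.norm_I, mul_one, Real.norm_eq_abs]
  refine mul_le_of_le_one_right (by positivity) ?_
  norm_num [Nat.factorial]

/-- The characteristic function of a centered Bernoulli variable is close, near the origin, to that
of the centered Gaussian of the same variance. -/
lemma norm_charFun_centered_bernoulli_sub_exp_le (p : unitInterval) {u : ℝ} (hu : |u| ≤ 1) :
    ‖charFun (bernoulliMeasure (1 - (p : ℝ)) (0 - (p : ℝ)) p) u
        - Complex.exp ((-((p : ℝ) * (1 - p) * u ^ 2 / 2) : ℝ))‖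
      ≤ 2 * ((p : ℝ) * (1 - p)) * |u| ^ 3 := by
  obtain ⟨p, hp0, hp1⟩ := p
  set q := 1 - p with hq
  have hq0 : 0 ≤ q := by linarith
  have hq1 : q ≤ 1 := by linarith
  have hu0 := abs_nonneg u
  have habs (x : ℝ) (hx0 : 0 ≤ x) (hx1 : x ≤ 1) : |u * x| ≤ 1 := by
    rw [abs_mul, abs_of_nonneg hx0]
    exact mul_le_one₀ hu hx0 hx1
  have h1 := norm_exp_mul_I_sub_taylor_two_le (habs q hq0 hq1)
  have h2 := norm_exp_mul_I_sub_taylor_two_le (x := -(u * p)) (by simpa using habs p hp0 hp1)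
  have hv0 : 0 ≤ p * q := by positivity
  have hv1 : p * q ≤ 1 := mul_le_one₀ hp1 hq0 hq1
  have hu2 : u ^ 2 ≤ 1 := by rw [← sq_abs]; exact pow_le_one₀ hu0 hu
  have hy : |(-(p * q * u ^ 2 / 2))| ≤ 1 := by
    rw [abs_neg, abs_of_nonneg (by positivity)]
    have := mul_le_one₀ hv1 (sq_nonneg u) hu2
    linarith
  have h3 := Complex.norm_exp_sub_one_sub_id_le
    (x := ((-(p * q * u ^ 2 / 2) : ℝ) : ℂ)) (by rwa [Complex.norm_real])
  rw [Complex.norm_real, Real.norm_eq_abs, abs_neg, abs_of_nonneg (by positivity)] at h3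
  -- Each error keeps a factor p * q, so that summing over the variables produces S_N rather than N.
  have h3' : (p * q * u ^ 2 / 2) ^ 2 ≤ p * q * |u| ^ 3 := by
    rw [← sq_abs u]
    have e : (p * q * |u| ^ 2 / 2) ^ 2 = (p * q * |u| ^ 3) * (p * q * |u|) / 4 := by ring
    have := mul_le_of_le_one_right (a := p * q * |u| ^ 3) (by positivity)
      (mul_le_one₀ hv1 hu0 hu)
    have : 0 ≤ p * q * |u| ^ 3 := by positivity
    rw [e]; linarith
  have h12 : p * |u * q| ^ 3 + q * |-(u * p)| ^ 3 ≤ p * q * |u| ^ 3 := by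
    rw [abs_neg, abs_mul, abs_mul, abs_of_nonneg hp0, abs_of_nonneg hq0]
    have e : p * (|u| * q) ^ 3 + q * (|u| * p) ^ 3
        = (p * q * |u| ^ 3) * (q ^ 2 + p ^ 2) := by ring
    rw [e]
    refine mul_le_of_le_one_right (by positivity) ?_
    nlinarith
  have hpq : (q : ℂ) = 1 - p := by simp [hq]
  rw [charFun_apply_real, integral_bernoulliMeasure]
  simp only [Complex.real_smul]
  rw [← hq, zero_sub]
  set A := Complex.exp (((u * q : ℝ) : ℂ) * Complex.I)
  set B := Complex.exp (((-(u * p) : ℝ) : ℂ) * Complex.I)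
  set G := Complex.exp ((-(p * q * u ^ 2 / 2) : ℝ) : ℂ)
  have eA : Complex.exp ((u : ℂ) * (q : ℝ) * Complex.I) = A := by simp [A]
  have eB : Complex.exp ((u : ℂ) * ((-p : ℝ) : ℂ) * Complex.I) = B := by simp [B]
  rw [eA, eB]
  -- Centering cancels the linear terms, and pq² + qp² = pq matches the quadratic ones; only Taylor
  -- remainders survive.
  have key : (p : ℂ) * A + (q : ℂ) * B - G
      = p * (A - (1 + ((u * q : ℝ) : ℂ) * Complex.I - ((u * q : ℝ) : ℂ) ^ 2 / 2))
        + q * (B - (1 + ((-(u * p) : ℝ) : ℂ) * Complex.I - ((-(u * p) : ℝ) : ℂ) ^ 2 / 2))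
        - (G - 1 - ((-(p * q * u ^ 2 / 2) : ℝ) : ℂ)) := by
    push_cast
    rw [hpq]
    ring
  calc ‖(p : ℂ) * A + (q : ℂ) * B - G‖
      ≤ p * |u * q| ^ 3 + q * |-(u * p)| ^ 3 + (p * q * u ^ 2 / 2) ^ 2 := by
        rw [key]
        grw [norm_sub_le, norm_add_le, norm_mul, norm_mul, h1, h2, h3]
        simp [abs_of_nonneg hp0, abs_of_nonneg hq0]
    _ ≤ 2 * (p * q) * |u| ^ 3 := by linarith

lemma charFun_map_mul_sum_sub_eq_prod {Ω : Type*} [MeasurableSpace Ω] {P : Measure Ω}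
    {ι : Type*} [Fintype ι] {p : ι → unitInterval} {Y : ι → Ω → ℝ}
    (hlaw : ∀ i, HasLaw (Y i) (bernoulliMeasure (1 : ℝ) 0 (p i)) P) (hindep : iIndepFun Y P)
    (c t : ℝ) :
    charFun (P.map fun ω => c * (∑ i, Y i ω - ∑ i, (p i : ℝ))) t
      = ∏ i, charFun (bernoulliMeasure (1 - (p i : ℝ)) (0 - (p i : ℝ)) (p i)) (c * t) := by
  have := hindep.isProbabilityMeasure
  have hm (i) : AEMeasurable (Y i) P := (hlaw i).aemeasurable
  have hcent : iIndepFun (fun i ω => Y i ω - (p i : ℝ)) P :=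
    hindep.comp (fun i x => x - (p i : ℝ)) (by fun_prop)
  simp_rw [← Finset.sum_sub_distrib]
  rw [charFun_map_mul_comp (Finset.aemeasurable_fun_sum _ fun i _ => (hm i).sub_const _),
    hcent.charFun_map_fun_sum_eq_prod fun i => (hm i).sub_const _, Finset.prod_apply]
  refine Finset.prod_congr rfl fun i _ => ?_
  have hmap : P.map (fun ω => Y i ω - (p i : ℝ))
      = bernoulliMeasure (1 - (p i : ℝ)) (0 - (p i : ℝ)) (p i) := by
    rw [← map_bernoulliMeasure (1 : ℝ) 0 (fun x => x - (p i : ℝ)), ← (hlaw i).map_eq,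
      AEMeasurable.map_map_of_aemeasurable (by fun_prop) (hm i), Function.comp_def]
  rw [hmap]

/-- Eventually a < p_i < b with 0 < a and b < 1, so the terms stay above a(1-b) > 0 and cannot be
summable. -/
lemma tendsto_sum_bernoulli_variance_atTop {p : ℕ → unitInterval}
    (hp_liminf : 0 < liminf (fun i => (p i : ℝ)) atTop)
    (hp_limsup : limsup (fun i => (p i : ℝ)) atTop < 1) :
    Tendsto (fun N => ∑ i : Fin N, (p i : ℝ) * (1 - (p i : ℝ))) atTop atTop := by
  have hnonneg (i) : 0 ≤ (p i : ℝ) * (1 - (p i : ℝ)) :=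
    mul_nonneg (p i).2.1 (sub_nonneg.2 (p i).2.2)
  simp_rw [Fin.sum_univ_eq_sum_range fun i => (p i : ℝ) * (1 - (p i : ℝ))]
  rw [← not_summable_iff_tendsto_nat_atTop_of_nonneg hnonneg]
  intro hs
  obtain ⟨a, ha0, ha⟩ := exists_between hp_liminf
  obtain ⟨b, hb, hb1⟩ := exists_between hp_limsup
  have h1 := eventually_lt_of_lt_liminf ha (isBoundedUnder_of ⟨0, fun i => (p i).2.1⟩)
  have h2 := eventually_lt_of_limsup_lt hb (isBoundedUnder_of ⟨1, fun i => (p i).2.2⟩)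
  have h3 := hs.tendsto_atTop_zero.eventually_lt_const (mul_pos ha0 (sub_pos.2 hb1))
  obtain ⟨i, hi1, hi2, hi3⟩ := (h1.and (h2.and h3)).exists
  have : a * (1 - b) ≤ (p i : ℝ) * (1 - p i) := by
    have hb0 := sub_pos.2 hb1
    have hp0 := (p i).2.1
    gcongr
  linarith

/-- For each `N`, the variables `Y N 0, …, Y N (N - 1)` are independent `0/1`-valued Bernoulli
variables with success probabilities `p 0, …, p (N - 1)`, on a probability space that may depend
on `N`. The limit `id` under `gaussianReal 0 1` is a standard normal variable. -/
theorem theorem1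
    (p : ℕ → unitInterval)
    (hp_liminf : 0 < liminf (fun i => (p i : ℝ)) atTop)
    (hp_limsup : limsup (fun i => (p i : ℝ)) atTop < 1)
    {Ω : ℕ → Type*} [∀ N, MeasurableSpace (Ω N)]
    (P : (N : ℕ) → Measure (Ω N)) [∀ N, IsProbabilityMeasure (P N)]
    (Y : (N : ℕ) → Fin N → Ω N → ℝ)
    (hY_law : ∀ N (i : Fin N), HasLaw (Y N i) (bernoulliMeasure (1 : ℝ) 0 (p i)) (P N))
    (hY_indep : ∀ N, iIndepFun (Y N) (P N)) :
    TendstoInDistribution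
      (fun (N : ℕ) (ω : Ω N) =>
        (1 / √(∑ i : Fin N, (p i : ℝ) * (1 - (p i : ℝ)))) *
          ((∑ i : Fin N, Y N i ω) - ∑ i : Fin N, (p i : ℝ)))
      atTop (id : ℝ → ℝ) P (gaussianReal 0 1) := by
  have hS := tendsto_sum_bernoulli_variance_atTop hp_liminf hp_limsup
  refine ⟨fun N => ((Finset.aemeasurable_fun_sum _ fun i _ =>
    (hY_law N i).aemeasurable).sub_const _).const_mul _, aemeasurable_id, ?_⟩
  refine ProbabilityMeasure.tendsto_iff_tendsto_charFun.2 fun t => ?_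
  simp only [ProbabilityMeasure.coe_mk, Measure.map_id, charFun_gaussianReal,
    fun N => charFun_map_mul_sum_sub_eq_prod (hY_law N) (hY_indep N)]
  set S : ℕ → ℝ := fun N => ∑ i : Fin N, (p i : ℝ) * (1 - (p i : ℝ)) with hSdef
  have hu : Tendsto (fun N => 1 / √(S N) * t) atTop (nhds 0) := by
    rw [← zero_mul t]
    simp_rw [one_div]
    exact (tendsto_inv_atTop_zero.comp (Real.tendsto_sqrt_atTop.comp hS)).mul_const t
  rw [tendsto_iff_norm_sub_tendsto_zero]
  have hbound : Tendsto (fun N => 2 * t ^ 2 * |1 / √(S N) * t|) atTop (nhds 0) := by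
    simpa using hu.abs.const_mul (2 * t ^ 2)
  have hu1 : ∀ᶠ N in atTop, |1 / √(S N) * t| < 1 :=
    hu.abs.eventually_lt_const (by simp)
  refine squeeze_zero' (.of_forall fun _ => norm_nonneg _) ?_ hbound
  filter_upwards [hu1, hS.eventually_gt_atTop 0] with N hN hSN
  set u := 1 / √(S N) * t with hudef
  have hSu : S N * u ^ 2 = t ^ 2 := by
    rw [hudef, mul_pow, div_pow, Real.sq_sqrt hSN.le]
    field_simp
  have hgauss : Complex.exp (t * ((0 : ℝ) : ℂ) * Complex.I - ((1 : NNReal) : ℝ) * t ^ 2 / 2)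
      = ∏ i : Fin N, Complex.exp ((-((p i : ℝ) * (1 - p i) * u ^ 2 / 2) : ℝ)) := by
    rw [← Complex.exp_sum, ← Complex.ofReal_sum, Finset.sum_neg_distrib, ← Finset.sum_div,
      ← Finset.sum_mul]
    change _ = Complex.exp ((-(S N * u ^ 2 / 2) : ℝ))
    rw [hSu]
    congr 1
    push_cast
    ring
  rw [hgauss]
  calc _ ≤ ∑ i : Fin N, 2 * ((p i : ℝ) * (1 - p i)) * |u| ^ 3 := by
        refine (norm_prod_sub_prod_le_sum _ _ _ (fun i _ => norm_charFun_le_one _)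
          fun i _ => ?_).trans
          (Finset.sum_le_sum fun i _ => norm_charFun_centered_bernoulli_sub_exp_le (p i) hN.le)
        rw [Complex.norm_exp, Complex.ofReal_re, Real.exp_le_one_iff, neg_nonpos]
        have := mul_nonneg (p i).2.1 (sub_nonneg.2 (p i).2.2)
        positivity
    _ = 2 * S N * |u| ^ 3 := by rw [← Finset.sum_mul, ← Finset.mul_sum]
    _ = 2 * t ^ 2 * |u| := by rw [← hSu, ← sq_abs u]; ring
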